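/- Let $\omega,\omega'\in\mathbb{C}$ be linearly independent over $\mathbb{R}$ and let $\Lambda=2\omega\mathbb{Z}+2\omega'\mathbb{Z}$. Let $$\sigma(x)=x\prod_{l\in\Lambda\setminus\{0\}}\Big(1-\frac{x}{l}\Big)\exp\Big(\frac{x}{l}+\frac{x^2}{2l^2}\Big),\qquad \zeta(x)=\frac{\sigma'(x)}{\sigma(x)},\qquad \wp(x)=\frac1{x^2}+\sum_{l\in\Lambda\setminus\{0\}}\Big(\frac1{(x-l)^2}-\frac1{l^2}\Big)=-\zeta'(x)$$ be the Weierstrass functions of $\Lambda$, and let $$\Phi(x;\nu)=\frac{\sigma(\nu-x)}{\sigma(\nu)\,\sigma(x)}\,e^{\zeta(\nu)x}$$ be the Baker–Akhiezer function. (i) For all $x,\alpha,\nu\in\mathbb{C}$ such that none of $x,\ \alpha,\ \nu,\ \nu-\alpha,\ x+\alpha$ lies in $\Lambda$, $$\Phi(x+\alpha;\nu)=-e^{(\zeta(\alpha-\nu)+\zeta(\nu)-\zeta(\alpha))x}\,\Phi(\alpha;\nu)\,\frac{\Phi(x;\nu-\alpha)}{\Phi(-x;\alpha)}.$$ (ii)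 For all $x,y,\nu_1,\nu_2\in\mathbb{C}$ such that none of $x,\ y,\ x+y,\ \nu_1,\ \nu_2,\ \nu_1+\nu_2$ lies in $\Lambda$, $$c\,e^{\gamma(x+y)}\,\Phi(x+y;\nu_1+\nu_2)=\Phi(x+y;\nu_1)\,\Phi(x;\nu_2)\,\Phi(y;\nu_2)-\Phi(x+y;\nu_2)\,\Phi(x;\nu_1)\,\Phi(y;\nu_1),$$ where $c=\wp(\nu_2)-\wp(\nu_1)$ and $\gamma=\zeta(\nu_1)+\zeta(\nu_2)-\zeta(\nu_1+\nu_2)$. -/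

import Mathlib

noncomputable section

/-- The Weierstrass sigma function of the lattice `Λ` of periods of `L`:
`σ(z) = z ∏ (1 - z / l) exp (z / l + z² / (2 l²))`, the product over the non-zero `l ∈ Λ`. -/
def PeriodPair.weierstrassSigma (L : PeriodPair) (z : ℂ) : ℂ :=
  z * ∏' l : {l : L.lattice // l ≠ 0},
    (1 - z / (l : ℂ)) * Complex.exp (z / (l : ℂ) + z ^ 2 / (2 * (l : ℂ) ^ 2))

/-- The Weierstrass zeta function `ζ = σ' / σ`, the logarithmic derivative of `σ`. -/
def PeriodPair.weierstrassZeta (L : PeriodPair) (z : ℂ) : ℂ :=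
  deriv L.weierstrassSigma z / L.weierstrassSigma z

/-- The Baker-Akhiezer function `Φ(x; ν) = σ(ν - x) / (σ(ν) σ(x)) * exp (ζ(ν) x)`. -/
def PeriodPair.bakerAkhiezer (L : PeriodPair) (x ν : ℂ) : ℂ :=
  L.weierstrassSigma (ν - x) / (L.weierstrassSigma ν * L.weierstrassSigma x) *
    Complex.exp (L.weierstrassZeta ν * x)

end

open Filter Topology

/-! Written out in sigma functions, (i) is a cancellation: both sides carry the same sigma quotient,
and the exponents agree because `ζ` is odd. Identity (ii) has substance. Both products on its right
carry the same exponential, and clearing denominators leaves a case of Weierstrass's three-term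
identity (`weierstrassSigma_three_term`), once `c` is expressed through `σ(a + b) σ(a - b) = σ(a)²
σ(b)² (℘(b) - ℘(a))`. That addition formula comes from Liouville's theorem: quasi-periodicity of `σ`
makes the difference of the sides, divided by `σ(a)²`, elliptic in `a`; it has no poles and vanishes
at `a = b`. Replacing `σ² ℘` by the entire function `σ'² - σ σ''` removes the poles from the
statement. -/

namespace PeriodPair


/-! ### The sigma function: convergence of the product, zeros, parity. -/

/-- The elementary factor `(1 - w) exp (w + w² / 2)` is `1 + O(w³)` on the unit disc. -/
lemma norm_elementaryFactor_sub_one_le {w : ℂ} (hw : ‖w‖ ≤ 1) :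
    ‖(1 - w) * Complex.exp (w + w ^ 2 / 2) - 1‖ ≤ Real.exp 2 * ‖w‖ ^ 3 := by
  -- The lower-order terms of the derivative cancel, leaving a factor `z²`; the mean value
  -- inequality on the disc of radius `‖w‖` supplies the third power.
  have hd (z : ℂ) : HasDerivAt (fun z : ℂ ↦ (1 - z) * Complex.exp (z + z ^ 2 / 2))
      (-z ^ 2 * Complex.exp (z + z ^ 2 / 2)) z := by
    have h1 : HasDerivAt (fun z : ℂ ↦ z + z ^ 2 / 2) (1 + z) z := by
      refine ((hasDerivAt_id z).add (((hasDerivAt_id z).pow 2).div_const 2)).congr_deriv ?_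
      simp
    refine (((hasDerivAt_id z).const_sub 1).mul h1.cexp).congr_deriv ?_
    simp only [id]
    ring
  have hb : ∀ z ∈ Metric.closedBall (0 : ℂ) ‖w‖,
      ‖-z ^ 2 * Complex.exp (z + z ^ 2 / 2)‖ ≤ Real.exp 2 * ‖w‖ ^ 2 := by
    intro z hz
    rw [mem_closedBall_zero_iff] at hz
    have hz1 : ‖z‖ ≤ 1 := hz.trans hw
    rw [norm_mul, norm_neg, norm_pow, mul_comm]
    have h2 : ‖z + z ^ 2 / 2‖ ≤ 2 := by
      refine (norm_add_le _ _).trans ?_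
      rw [norm_div, norm_pow, Complex.norm_ofNat]
      nlinarith [norm_nonneg z]
    gcongr
    rw [Complex.norm_exp]
    exact Real.exp_le_exp.mpr ((Complex.re_le_norm _).trans h2)
  have := (convex_closedBall (0 : ℂ) ‖w‖).norm_image_sub_le_of_norm_hasDerivWithin_le
    (fun z _ ↦ (hd z).hasDerivWithinAt) hb (x := 0) (y := w) (by simp) (by simp)
  simpa [pow_succ, mul_assoc] using this

variable (L : PeriodPair)

/-- The factor of the Weierstrass sigma function with zero `l`. -/
noncomputable def sigmaFactor (l z : ℂ) : ℂ :=
  (1 - z / l) * Complex.exp (z / l + z ^ 2 / (2 * l ^ 2))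

lemma differentiable_sigmaFactor (l : ℂ) : Differentiable ℂ (sigmaFactor l) := by
  unfold sigmaFactor
  fun_prop

lemma norm_sigmaFactor_sub_one_le {l z : ℂ} (h : ‖z‖ ≤ ‖l‖) :
    ‖sigmaFactor l z - 1‖ ≤ Real.exp 2 * ‖z‖ ^ 3 * ‖l‖ ^ (-3 : ℝ) := by
  have h1 : ‖z / l‖ ≤ 1 := by
    rw [norm_div]
    exact div_le_one_of_le₀ h (norm_nonneg _)
  refine le_trans (le_of_eq ?_) ((norm_elementaryFactor_sub_one_le h1).trans_eq ?_)
  · rw [sigmaFactor, div_pow, div_div, mul_comm (l ^ 2) 2]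
  · rw [norm_div, div_pow, show (-3 : ℝ) = ((-3 : ℤ) : ℝ) by norm_num, Real.rpow_intCast,
      mul_assoc, div_eq_mul_inv]
    rfl

lemma sigmaFactor_ne_zero {l z : ℂ} (hl : l ≠ 0) (h : z ≠ l) : sigmaFactor l z ≠ 0 := by
  refine mul_ne_zero (sub_ne_zero.mpr fun e ↦ h ?_) (Complex.exp_ne_zero _)
  exact ((div_eq_one_iff_eq hl).mp e.symm)

lemma logDeriv_sigmaFactor {l z : ℂ} (hl : l ≠ 0) (h : z ≠ l) :
    logDeriv (sigmaFactor l) z = 1 / (z - l) + 1 / l + z / l ^ 2 := by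
  have h1 : HasDerivAt (fun z : ℂ ↦ 1 - z / l) (-(1 / l)) z :=
    ((hasDerivAt_id z).div_const l).const_sub 1
  have h2 : HasDerivAt (fun z : ℂ ↦ z / l + z ^ 2 / (2 * l ^ 2)) (1 / l + z / l ^ 2) z := by
    refine (((hasDerivAt_id z).div_const l).add
      (((hasDerivAt_id z).pow 2).div_const (2 * l ^ 2))).congr_deriv ?_
    simp
    field_simp
  have h3 : sigmaFactor l z ≠ 0 := sigmaFactor_ne_zero hl h
  have h4 : l - z ≠ 0 := sub_ne_zero.mpr h.symm
  have h5 : z - l ≠ 0 := sub_ne_zero.mpr h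
  rw [logDeriv_apply, show deriv (sigmaFactor l) z = _ from (h1.mul h2.cexp).deriv,
    div_eq_iff h3, sigmaFactor]
  rw [show (1 : ℂ) - z / l = (l - z) / l by field_simp]
  field_simp
  ring

/-- The Weierstrass sigma function divided by the identity. -/
noncomputable def sigmaProd (z : ℂ) : ℂ := ∏' l : {l : L.lattice // l ≠ 0}, sigmaFactor l z

lemma weierstrassSigma_eq (z : ℂ) : L.weierstrassSigma z = z * L.sigmaProd z := rfl

lemma summable_norm_rpow_ne_zero :
    Summable fun l : {l : L.lattice // l ≠ 0} ↦ ‖(l : ℂ)‖ ^ (-3 : ℝ) :=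
  (ZLattice.summable_norm_rpow L.lattice (-3) (by simp; norm_num)).subtype _

lemma eventually_le_norm (r : ℝ) :
    ∀ᶠ l : {l : L.lattice // l ≠ 0} in cofinite, r ≤ ‖(l : ℂ)‖ := by
  have : Set.Finite {l : L.lattice | ‖l.1‖ < r} :=
    (isCompact_iff_finite.mp (isCompact_closedBall (0 : L.lattice) r)).subset fun l hl ↦ by
      simpa using le_of_lt hl
  refine (this.preimage Subtype.val_injective.injOn).subset fun l hl ↦ ?_
  simpa using hl

lemma eventually_norm_sigmaFactor_sub_one_le (r : ℝ) :
    ∀ᶠ l : {l : L.lattice // l ≠ 0} in cofinite, ∀ z ∈ Metric.ball (0 : ℂ) r,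
      ‖sigmaFactor l z - 1‖ ≤ Real.exp 2 * r ^ 3 * ‖(l : ℂ)‖ ^ (-3 : ℝ) := by
  filter_upwards [L.eventually_le_norm r] with l hl z hz
  rw [mem_ball_zero_iff] at hz
  refine (norm_sigmaFactor_sub_one_le (hz.le.trans hl)).trans ?_
  gcongr

lemma multipliableLocallyUniformlyOn_sigmaFactor (r : ℝ) :
    MultipliableLocallyUniformlyOn (fun (l : {l : L.lattice // l ≠ 0}) z ↦ sigmaFactor l z)
      (Metric.ball (0 : ℂ) r) := by
  have := Summable.multipliableLocallyUniformlyOn_one_add (K := Metric.ball (0 : ℂ) r)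
    (f := fun (l : {l : L.lattice // l ≠ 0}) z ↦ sigmaFactor l z - 1) Metric.isOpen_ball
    (L.summable_norm_rpow_ne_zero.mul_left (Real.exp 2 * r ^ 3))
    (L.eventually_norm_sigmaFactor_sub_one_le r)
    (fun l ↦ ((differentiable_sigmaFactor l).continuous.sub continuous_const).continuousOn)
  simpa using this

lemma differentiable_sigmaProd : Differentiable ℂ L.sigmaProd := by
  intro z
  have hz : z ∈ Metric.ball (0 : ℂ) (‖z‖ + 1) := by simp
  refine DifferentiableOn.differentiableAt ?_ (Metric.isOpen_ball.mem_nhds hz)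
  exact (L.multipliableLocallyUniformlyOn_sigmaFactor _).hasProdLocallyUniformlyOn.differentiableOn
    (.of_forall fun s ↦ .fun_finsetProd fun l _ ↦
      (differentiable_sigmaFactor l).differentiableOn) Metric.isOpen_ball

/-- An absolutely convergent product vanishes only if a factor does. The origin is allowed, since
the factor `z` has been split off. -/
lemma sigmaProd_ne_zero {z : ℂ} (hz : z ∈ L.lattice → z = 0) : L.sigmaProd z ≠ 0 := by
  have := tprod_one_add_ne_zero_of_summable
    (f := fun l : {l : L.lattice // l ≠ 0} ↦ sigmaFactor l z - 1) (fun l ↦ ?_) ?_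
  · simpa [sigmaProd] using this
  · rw [add_sub_cancel]
    have hl : (l : ℂ) ≠ 0 := by simpa using l.2
    exact sigmaFactor_ne_zero hl fun e ↦ hl (e ▸ hz (e ▸ l.1.2))
  · refine Summable.of_norm_bounded_eventually
      (L.summable_norm_rpow_ne_zero.mul_left (Real.exp 2 * (‖z‖ + 1) ^ 3)) ?_
    filter_upwards [L.eventually_norm_sigmaFactor_sub_one_le (‖z‖ + 1)] with l hl
    simpa using hl z (by simp)

@[simp]
lemma sigmaProd_zero : L.sigmaProd 0 = 1 := by simp [sigmaProd, sigmaFactor]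

lemma sigmaProd_eq_zero {z : ℂ} (hz : z ∈ L.lattice) (hz0 : z ≠ 0) : L.sigmaProd z = 0 := by
  refine tprod_of_exists_eq_zero ⟨⟨⟨z, hz⟩, by simpa using hz0⟩, ?_⟩
  simp [sigmaFactor, hz0]

@[simp]
lemma sigmaProd_neg (z : ℂ) : L.sigmaProd (-z) = L.sigmaProd z := by
  let e : {l : L.lattice // l ≠ 0} ≃ {l : L.lattice // l ≠ 0} :=
    (Equiv.neg L.lattice).subtypeEquiv (by simp)
  rw [sigmaProd, ← e.tprod_eq]
  refine tprod_congr fun l ↦ ?_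
  simp [e, sigmaFactor]

lemma differentiable_weierstrassSigma : Differentiable ℂ L.weierstrassSigma :=
  differentiable_id.mul L.differentiable_sigmaProd

lemma differentiable_deriv_weierstrassSigma : Differentiable ℂ (deriv L.weierstrassSigma) :=
  L.differentiable_weierstrassSigma.deriv

@[simp]
lemma weierstrassSigma_neg (z : ℂ) : L.weierstrassSigma (-z) = -L.weierstrassSigma z := by
  simp [weierstrassSigma_eq]

lemma weierstrassSigma_eq_zero_iff {z : ℂ} : L.weierstrassSigma z = 0 ↔ z ∈ L.lattice := by
  rw [weierstrassSigma_eq, mul_eq_zero]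
  constructor
  · rintro (rfl | h)
    · exact zero_mem _
    · by_contra hz
      exact L.sigmaProd_ne_zero (fun h ↦ absurd h hz) h
  · intro hz
    by_cases h0 : z = 0
    · exact .inl h0
    · exact .inr (L.sigmaProd_eq_zero hz h0)

@[simp]
lemma deriv_weierstrassSigma_neg (z : ℂ) :
    deriv L.weierstrassSigma (-z) = deriv L.weierstrassSigma z := by
  have := deriv_comp_neg L.weierstrassSigma z
  simp only [weierstrassSigma_neg, deriv.fun_neg] at this
  exact (neg_injective this).symm

@[simp]
lemma deriv_weierstrassSigma_zero : deriv L.weierstrassSigma 0 = 1 := by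
  have := ((hasDerivAt_id (0 : ℂ)).mul (L.differentiable_sigmaProd 0).hasDerivAt).deriv
  simpa using! this

@[simp]
lemma weierstrassZeta_neg (z : ℂ) : L.weierstrassZeta (-z) = -L.weierstrassZeta z := by
  simp [weierstrassZeta, div_neg]


/-! ### The zeta function: partial fractions, derivative, quasi-periodicity. -/

/-- The partial fraction series of the Weierstrass zeta function. -/
noncomputable def zetaSeries (z : ℂ) : ℂ := ∑' l : L.lattice, (1 / (z - l) + 1 / l + z / l ^ 2)

lemma zetaSummand_bound {r : ℝ} {s l : ℂ} (hs : ‖s‖ < r) (h : 2 * r ≤ ‖l‖) :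
    ‖1 / (s - l) + 1 / l + s / l ^ 2‖ ≤ 2 * r ^ 2 * ‖l‖ ^ (-3 : ℝ) := by
  have hr : 0 < r := (norm_nonneg s).trans_lt hs
  have hl : 0 < ‖l‖ := by linarith
  have hl0 : l ≠ 0 := norm_pos_iff.mp hl
  have hsl : ‖l‖ / 2 ≤ ‖s - l‖ := by
    rw [norm_sub_rev]
    exact .trans (by linarith) (norm_sub_norm_le l s)
  have hsl0 : s - l ≠ 0 := norm_pos_iff.mp (by linarith)
  have : 1 / (s - l) + 1 / l + s / l ^ 2 = s ^ 2 / (l ^ 2 * (s - l)) := by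
    field_simp
    ring
  rw [this, norm_div, norm_mul, norm_pow, norm_pow]
  calc
    _ ≤ r ^ 2 / (‖l‖ ^ 2 * (‖l‖ / 2)) := by gcongr
    _ = 2 * r ^ 2 / ‖l‖ ^ 3 := by field
    _ = _ := by norm_cast

lemma hasSumLocallyUniformly_zetaSeries :
    HasSumLocallyUniformly (fun (l : L.lattice) (z : ℂ) ↦ 1 / (z - l) + 1 / l + z / l ^ 2)
      L.zetaSeries :=
  L.hasSumLocallyUniformly_aux (u := (2 * · ^ 2 * ‖·‖ ^ (-3 : ℝ))) _
    (fun _ _ ↦ (ZLattice.summable_norm_rpow _ _ (by simp; norm_num)).mul_left _) fun r hr ↦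
    Filter.eventually_atTop.mpr ⟨2 * r, by
      rintro _ h s hs l rfl
      exact zetaSummand_bound hs h⟩

lemma hasDerivAt_zetaSummand {z l : ℂ} (h : z ≠ l) :
    HasDerivAt (fun z : ℂ ↦ 1 / (z - l) + 1 / l + z / l ^ 2)
      (-(1 / (z - l) ^ 2 - 1 / l ^ 2)) z := by
  have h1 := ((hasDerivAt_id z).sub_const l).fun_inv (sub_ne_zero.mpr h)
  have h2 := (h1.add_const (1 / l)).add ((hasDerivAt_id z).div_const (l ^ 2))
  simp only [id, inv_eq_one_div] at h2
  refine h2.congr_deriv ?_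
  ring

lemma isOpen_compl_lattice : IsOpen (L.latticeᶜ : Set ℂ) := L.isClosed_lattice.isOpen_compl

/-- Lets a function with zero derivative off the lattice be constant there. -/
lemma isPreconnected_compl_lattice : IsPreconnected (L.latticeᶜ : Set ℂ) :=
  (Set.Countable.isConnected_compl_of_one_lt_rank (by simp)
    (countable_of_Lindelof_of_discrete (X := L.lattice))).2

lemma dense_compl_lattice : Dense (L.latticeᶜ : Set ℂ) :=
  Set.Countable.dense_compl ℝ (countable_of_Lindelof_of_discrete (X := L.lattice))

lemma ne_of_notMem_lattice {z : ℂ} (hz : z ∉ L.lattice) (l : L.lattice) : z ≠ l :=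
  fun e ↦ hz (e ▸ l.2)

lemma hasDerivAt_zetaSeries {z : ℂ} (hz : z ∉ L.lattice) :
    HasDerivAt L.zetaSeries (-L.weierstrassP z) z := by
  have := hasDerivAt_of_tendstoLocallyUniformlyOn L.isOpen_compl_lattice
    (L.hasSumLocallyUniformly_weierstrassP.tendstoLocallyUniformlyOn (s := L.latticeᶜ))
    (f := fun (s : Finset L.lattice) z ↦ ∑ l ∈ s, -(1 / (z - (l : ℂ)) + 1 / (l : ℂ) + z / (l : ℂ) ^ 2))
    (g := fun z ↦ -L.zetaSeries z)
    (.of_forall fun s x hx ↦ .fun_sum fun l _ ↦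
      (hasDerivAt_zetaSummand (L.ne_of_notMem_lattice hx l)).neg.congr_deriv (neg_neg _))
    (fun x _ ↦ L.hasSumLocallyUniformly_zetaSeries.hasSum.neg) hz
  exact this.neg.congr_of_eventuallyEq (.of_forall fun w ↦ (neg_neg _).symm)

lemma weierstrassZeta_eq_zetaSeries {z : ℂ} (hz : z ∉ L.lattice) :
    L.weierstrassZeta z = L.zetaSeries z := by
  have hz0 : z ≠ 0 := fun e ↦ hz (e ▸ zero_mem _)
  have hP : L.sigmaProd z ≠ 0 := L.sigmaProd_ne_zero fun h ↦ absurd h hz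
  have hl (l : {l : L.lattice // l ≠ 0}) : (l : ℂ) ≠ 0 := by simpa using l.2
  have hne (l : {l : L.lattice // l ≠ 0}) : z ≠ l := L.ne_of_notMem_lattice hz l
  have hs := L.hasSumLocallyUniformly_zetaSeries.hasSum (x := z)
  have hlog : logDeriv L.sigmaProd z =
      ∑' l : {l : L.lattice // l ≠ 0}, logDeriv (sigmaFactor l) z := by
    refine logDeriv_tprod_eq_tsum (Metric.isOpen_ball (x := 0) (ε := ‖z‖ + 1)) (by simp)
      (fun l ↦ sigmaFactor_ne_zero (hl l) (hne l))
      (fun l ↦ (differentiable_sigmaFactor l).differentiableOn) ?_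
      (L.multipliableLocallyUniformlyOn_sigmaFactor _) hP
    simp_rw [logDeriv_sigmaFactor (hl _) (hne _)]
    exact hs.summable.subtype _
  calc
    L.weierstrassZeta z = logDeriv (fun z ↦ z * L.sigmaProd z) z := rfl
    _ = 1 / z + logDeriv L.sigmaProd z := by
      refine (logDeriv_mul (f := id) z hz0 hP differentiableAt_id
        (L.differentiable_sigmaProd z)).trans ?_
      simp [logDeriv_apply]
    _ = _ := by
      -- The term `l = 0` of the series is `1 / z`, since division by zero gives `0`.
      rw [hlog, zetaSeries, hs.summable.tsum_eq_add_tsum_ite 0]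
      simp_rw [logDeriv_sigmaFactor (hl _) (hne _)]
      congr 1
      · simp
      · refine (tsum_subtype {l : L.lattice | l ≠ 0}
          (fun l : L.lattice ↦ 1 / (z - l) + 1 / (l : ℂ) + z / (l : ℂ) ^ 2)).trans
          (tsum_congr fun l ↦ ?_)
        by_cases h : l = 0 <;> simp [h]

lemma hasDerivAt_weierstrassZeta {z : ℂ} (hz : z ∉ L.lattice) :
    HasDerivAt L.weierstrassZeta (-L.weierstrassP z) z := by
  refine (L.hasDerivAt_zetaSeries hz).congr_of_eventuallyEq ?_
  filter_upwards [L.isOpen_compl_lattice.mem_nhds hz] with w hw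
  exact L.weierstrassZeta_eq_zetaSeries hw

/-- The difference has derivative `℘(z) - ℘(z + l) = 0`. Lattice points are excluded because `ζ`
takes the default value `0` there. -/
lemma exists_weierstrassZeta_add_coe (l : L.lattice) :
    ∃ η : ℂ, ∀ z ∉ L.lattice, L.weierstrassZeta (z + l) = L.weierstrassZeta z + η := by
  have hd (z : ℂ) (hz : z ∈ (L.latticeᶜ : Set ℂ)) :
      HasDerivAt (fun z ↦ L.weierstrassZeta (z + l) - L.weierstrassZeta z) 0 z := by
    have h1 : z + l ∉ L.lattice := fun h ↦ hz (by simpa using sub_mem h l.2)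
    have h2 := ((L.hasDerivAt_weierstrassZeta h1).comp_add_const z l.1).sub
      (L.hasDerivAt_weierstrassZeta hz)
    exact h2.congr_deriv (by simp)
  obtain ⟨η, hη⟩ := L.isOpen_compl_lattice.exists_is_const_of_deriv_eq_zero
    L.isPreconnected_compl_lattice
    (fun z hz ↦ (hd z hz).differentiableAt.differentiableWithinAt) (fun z hz ↦ (hd z hz).deriv)
  exact ⟨η, fun z hz ↦ by linear_combination hη z hz⟩

lemma hasDerivAt_weierstrassSigma {z : ℂ} (hz : z ∉ L.lattice) :
    HasDerivAt L.weierstrassSigma (L.weierstrassZeta z * L.weierstrassSigma z) z := by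
  refine (L.differentiable_weierstrassSigma z).hasDerivAt.congr_deriv ?_
  rw [weierstrassZeta, div_mul_cancel₀ _ (L.weierstrassSigma_eq_zero_iff.not.mpr hz)]

/-- Quasi-periodicity of the Weierstrass sigma function. -/
lemma exists_weierstrassSigma_add_coe (l : L.lattice) :
    ∃ C η : ℂ, C ≠ 0 ∧ ∀ z,
      L.weierstrassSigma (z + l) = C * Complex.exp (η * z) * L.weierstrassSigma z := by
  obtain ⟨η, hη⟩ := L.exists_weierstrassZeta_add_coe l
  have hadd {z : ℂ} (hz : z ∉ L.lattice) : z + l ∉ L.lattice :=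
    fun h ↦ hz (by simpa using sub_mem h l.2)
  have hne {z : ℂ} (hz : z ∉ L.lattice) : L.weierstrassSigma z ≠ 0 :=
    L.weierstrassSigma_eq_zero_iff.not.mpr hz
  -- The logarithmic derivative of this quotient is `ζ(z + l) - η - ζ(z) = 0`.
  have hd (z : ℂ) (hz : z ∈ (L.latticeᶜ : Set ℂ)) :
      HasDerivAt (fun z ↦ L.weierstrassSigma (z + l) /
        (Complex.exp (η * z) * L.weierstrassSigma z)) 0 z := by
    have h1 := (L.hasDerivAt_weierstrassSigma (hadd hz)).comp_add_const z l.1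
    have h2 := ((hasDerivAt_id z).const_mul η).cexp.mul (L.hasDerivAt_weierstrassSigma hz)
    refine (h1.div h2 (mul_ne_zero (Complex.exp_ne_zero _) (hne hz))).congr_deriv ?_
    rw [hη z hz]
    simp only [id, Pi.mul_apply]
    ring
  obtain ⟨C, hC⟩ := L.isOpen_compl_lattice.exists_is_const_of_deriv_eq_zero
    L.isPreconnected_compl_lattice
    (fun z hz ↦ (hd z hz).differentiableAt.differentiableWithinAt) (fun z hz ↦ (hd z hz).deriv)
  have hC' {z : ℂ} (hz : z ∉ L.lattice) : L.weierstrassSigma (z + l) =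
      C * Complex.exp (η * z) * L.weierstrassSigma z := by
    rw [mul_assoc, ← div_eq_iff (mul_ne_zero (Complex.exp_ne_zero _) (hne hz))]
    exact hC z hz
  refine ⟨C, η, ?_, fun z ↦ ?_⟩
  · rintro rfl
    have := hC' L.ω₁_div_two_notMem_lattice
    simp only [zero_mul] at this
    exact hne (hadd L.ω₁_div_two_notMem_lattice) this
  · by_cases hz : z ∈ L.lattice
    · rw [L.weierstrassSigma_eq_zero_iff.mpr hz,
        L.weierstrassSigma_eq_zero_iff.mpr (add_mem hz l.2), mul_zero]
    · exact hC' hz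


/-! ### The addition formula for sigma, by Liouville's theorem. -/

/-- The entire function `σ'² - σ σ''`, equal to `σ² ℘` off the lattice. -/
noncomputable def sigmaSqWeierstrassP (z : ℂ) : ℂ :=
  deriv L.weierstrassSigma z ^ 2 - L.weierstrassSigma z * deriv (deriv L.weierstrassSigma) z

lemma differentiable_sigmaSqWeierstrassP : Differentiable ℂ L.sigmaSqWeierstrassP :=
  (L.differentiable_deriv_weierstrassSigma.pow 2).sub
    (L.differentiable_weierstrassSigma.mul L.differentiable_deriv_weierstrassSigma.deriv)

lemma sigmaSqWeierstrassP_eq {z : ℂ} (hz : z ∉ L.lattice) :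
    L.sigmaSqWeierstrassP z = L.weierstrassSigma z ^ 2 * L.weierstrassP z := by
  have hne : L.weierstrassSigma z ≠ 0 := L.weierstrassSigma_eq_zero_iff.not.mpr hz
  have h := ((L.differentiable_deriv_weierstrassSigma z).hasDerivAt.div
    (L.differentiable_weierstrassSigma z).hasDerivAt hne).unique (L.hasDerivAt_weierstrassZeta hz)
  rw [div_eq_iff (pow_ne_zero 2 hne)] at h
  rw [sigmaSqWeierstrassP]
  linear_combination -h

@[simp]
lemma sigmaSqWeierstrassP_neg (z : ℂ) :
    L.sigmaSqWeierstrassP (-z) = L.sigmaSqWeierstrassP z := by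
  have h := deriv_comp_neg (deriv L.weierstrassSigma) z
  simp only [deriv_weierstrassSigma_neg] at h
  simp [sigmaSqWeierstrassP, h]

lemma weierstrassSigma_of_mem {z : ℂ} (hz : z ∈ L.lattice) : L.weierstrassSigma z = 0 :=
  L.weierstrassSigma_eq_zero_iff.mpr hz

lemma sigmaSqWeierstrassP_zero : L.sigmaSqWeierstrassP 0 = 1 := by
  simp [sigmaSqWeierstrassP, L.weierstrassSigma_of_mem (zero_mem _)]

/-- An even entire function vanishing at `0` has a double zero there. -/
lemma exists_eq_sq_mul_of_even {h : ℂ → ℂ} (hd : Differentiable ℂ h) (heven : ∀ z, h (-z) = h z)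
    (h0 : h 0 = 0) : ∃ k : ℂ → ℂ, Differentiable ℂ k ∧ ∀ z, h z = z ^ 2 * k z := by
  have hslope {g : ℂ → ℂ} (hg : Differentiable ℂ g) : Differentiable ℂ (dslope g 0) := by
    rw [← differentiableOn_univ] at hg ⊢
    exact (Complex.differentiableOn_dslope univ_mem).mpr hg
  have hmul {g : ℂ → ℂ} (hg : g 0 = 0) (z : ℂ) : g z = z * dslope g 0 z := by
    simpa [hg] using (sub_smul_dslope g 0 z).symm
  -- The derivative of an even function is odd, so it vanishes at `0`.
  have h1 : dslope h 0 0 = 0 := by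
    have := deriv_comp_neg h 0
    simp only [heven, neg_zero] at this
    rw [dslope_same]
    exact CharZero.eq_neg_self_iff.mp this
  refine ⟨dslope (dslope h 0) 0, hslope (hslope hd), fun z ↦ ?_⟩
  rw [hmul h0, hmul h1, sq, mul_assoc]

/-- An even entire function `h` vanishing at `0` such that `h / σ²` is periodic is a multiple
of `σ²`. -/
lemma exists_eq_mul_weierstrassSigma_sq {h : ℂ → ℂ} (hd : Differentiable ℂ h)
    (heven : ∀ z, h (-z) = h z) (h0 : h 0 = 0)
    (hper : ∀ z ∉ L.lattice, ∀ l : L.lattice,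
      h (z + l) / L.weierstrassSigma (z + l) ^ 2 = h z / L.weierstrassSigma z ^ 2) :
    ∃ c, ∀ z ∉ L.lattice, h z = c * L.weierstrassSigma z ^ 2 := by
  classical
  obtain ⟨k, hk, hhk⟩ := exists_eq_sq_mul_of_even hd heven h0
  -- The value `k 0` removes the singularity: near `0` the quotient is `k / sigmaProd²`, and
  -- `sigmaProd 0 = 1`. Periodicity carries this to every lattice point.
  let Q (z : ℂ) : ℂ := if z ∈ L.lattice then k 0 else h z / L.weierstrassSigma z ^ 2
  have hQ0 : DifferentiableAt ℂ Q 0 := by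
    have hP : L.sigmaProd 0 ^ 2 ≠ 0 := by simp
    refine ((hk 0).div ((L.differentiable_sigmaProd 0).pow 2) hP).congr_of_eventuallyEq ?_
    filter_upwards [L.compl_lattice_sdiff_singleton_mem_nhds 0] with z hz
    by_cases hz0 : z = 0
    · simp [Q, hz0]
    · have hz' : z ∉ L.lattice := fun hm ↦ hz ⟨hm, hz0⟩
      simp only [Q, if_neg hz', hhk, weierstrassSigma_eq, Pi.div_apply, Pi.pow_apply, mul_pow]
      rw [mul_div_mul_left _ _ (pow_ne_zero 2 hz0)]
  have hQper (z : ℂ) (l : L.lattice) : Q (z + l) = Q z := by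
    have hiff : z + l ∈ L.lattice ↔ z ∈ L.lattice :=
      L.lattice.toAddSubgroup.add_mem_cancel_right l.2
    by_cases hz : z ∈ L.lattice
    · simp [Q, hz, hiff]
    · simp only [Q, hz, hiff, if_false, hper z hz l]
  have hQ : Differentiable ℂ Q := by
    intro z
    by_cases hz : z ∈ L.lattice
    · have : DifferentiableAt ℂ (fun w ↦ Q (w - z)) z := by
        refine DifferentiableAt.comp z (g := Q) ?_ (differentiableAt_id.sub_const z)
        simpa using hQ0
      refine this.congr_of_eventuallyEq (.of_forall fun w ↦ ?_)
      simpa using hQper (w - z) ⟨z, hz⟩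
    · have hne : L.weierstrassSigma z ^ 2 ≠ 0 :=
        pow_ne_zero 2 (L.weierstrassSigma_eq_zero_iff.not.mpr hz)
      refine ((hd z).div ((L.differentiable_weierstrassSigma z).pow 2) hne).congr_of_eventuallyEq ?_
      filter_upwards [L.isOpen_compl_lattice.mem_nhds hz] with w hw
      exact if_neg hw
  refine ⟨Q 0, fun z hz ↦ ?_⟩
  have hne : L.weierstrassSigma z ^ 2 ≠ 0 :=
    pow_ne_zero 2 (L.weierstrassSigma_eq_zero_iff.not.mpr hz)
  -- Liouville: a continuous periodic function has compact range.
  rw [← div_eq_iff hne, ← hQ.apply_eq_apply_of_bounded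
    (IsZLattice.isCompact_range_of_periodic L.lattice _ hQ.continuous
      fun z w hw ↦ hQper z ⟨w, hw⟩).isBounded z 0]
  exact (if_neg hz).symm

lemma weierstrassSigma_add_mul_sub_of_notMem {a b : ℂ} (ha : a ∉ L.lattice) (hb : b ∉ L.lattice) :
    L.weierstrassSigma (a + b) * L.weierstrassSigma (a - b) =
      L.weierstrassSigma a ^ 2 * L.sigmaSqWeierstrassP b -
        L.weierstrassSigma b ^ 2 * L.sigmaSqWeierstrassP a := by
  let h (z : ℂ) : ℂ := L.weierstrassSigma (z + b) * L.weierstrassSigma (z - b) -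
    (L.weierstrassSigma z ^ 2 * L.sigmaSqWeierstrassP b -
      L.weierstrassSigma b ^ 2 * L.sigmaSqWeierstrassP z)
  have hσ := L.differentiable_weierstrassSigma
  have hσb : L.weierstrassSigma b ≠ 0 := L.weierstrassSigma_eq_zero_iff.not.mpr hb
  have hd : Differentiable ℂ h := by
    have := L.differentiable_sigmaSqWeierstrassP
    fun_prop
  have heven (z : ℂ) : h (-z) = h z := by
    simp only [h]
    rw [show -z + b = -(z - b) by ring, show -z - b = -(z + b) by ring]
    simp only [weierstrassSigma_neg, sigmaSqWeierstrassP_neg]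
    ring
  have h0 : h 0 = 0 := by
    simp only [h, zero_add, zero_sub, weierstrassSigma_neg, sigmaSqWeierstrassP_zero,
      L.weierstrassSigma_of_mem (zero_mem _)]
    ring
  have hper (z : ℂ) (hz : z ∉ L.lattice) (l : L.lattice) :
      h (z + l) / L.weierstrassSigma (z + l) ^ 2 = h z / L.weierstrassSigma z ^ 2 := by
    obtain ⟨C, η, hC, hl⟩ := L.exists_weierstrassSigma_add_coe l
    have hzl : z + l ∉ L.lattice := fun h ↦ hz (by simpa using sub_mem h l.2)
    -- The shifts by `b` and `-b` cancel, so the product acquires the same multiplier as `σ(z)²`.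
    have he : Complex.exp (η * (z + b)) * Complex.exp (η * (z - b)) =
        Complex.exp (η * z) ^ 2 := by
      rw [← Complex.exp_add, ← Complex.exp_nat_mul]
      congr 1
      push_cast
      ring
    have hfac : (C * Complex.exp (η * z)) ^ 2 ≠ 0 :=
      pow_ne_zero 2 (mul_ne_zero hC (Complex.exp_ne_zero _))
    have hh : h (z + l) = (C * Complex.exp (η * z)) ^ 2 * h z := by
      simp only [h]
      rw [L.sigmaSqWeierstrassP_eq hzl, L.sigmaSqWeierstrassP_eq hz, weierstrassP_add_coe,
        add_right_comm, add_sub_right_comm, hl, hl, hl]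
      linear_combination
        (C ^ 2 * L.weierstrassSigma (z + b) * L.weierstrassSigma (z - b)) * he
    rw [hh, hl, mul_pow _ (L.weierstrassSigma z), mul_div_mul_left _ _ hfac]
  obtain ⟨c, hc⟩ := L.exists_eq_mul_weierstrassSigma_sq hd heven h0 hper
  -- At `z = b` both sides of the formula vanish while `σ(b) ≠ 0`.
  have hc0 : c = 0 := by
    have hb0 : h b = 0 := by
      simp only [h, sub_self, L.weierstrassSigma_of_mem (zero_mem _), mul_zero]
    rw [hc b hb] at hb0
    exact (mul_eq_zero.mp hb0).resolve_right (pow_ne_zero 2 hσb)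
  have := hc a ha
  rw [hc0, zero_mul] at this
  exact sub_eq_zero.mp this

/-- The addition formula `σ(a + b) σ(a - b) = σ(a)² σ(b)² (℘(b) - ℘(a))`, in a form valid for
all `a` and `b`. -/
lemma weierstrassSigma_add_mul_sub (a b : ℂ) :
    L.weierstrassSigma (a + b) * L.weierstrassSigma (a - b) =
      L.weierstrassSigma a ^ 2 * L.sigmaSqWeierstrassP b -
        L.weierstrassSigma b ^ 2 * L.sigmaSqWeierstrassP a := by
  have hdense (F G : ℂ → ℂ) (hF : Continuous F) (hG : Continuous G)
      (h : ∀ z ∉ L.lattice, F z = G z) (z : ℂ) : F z = G z :=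
    congrFun (hF.ext_on L.dense_compl_lattice hG h) z
  have hσ := L.differentiable_weierstrassSigma.continuous
  have hf := L.differentiable_sigmaSqWeierstrassP.continuous
  refine hdense (fun a ↦ L.weierstrassSigma (a + b) * L.weierstrassSigma (a - b)) (fun a ↦
    L.weierstrassSigma a ^ 2 * L.sigmaSqWeierstrassP b -
      L.weierstrassSigma b ^ 2 * L.sigmaSqWeierstrassP a) (by fun_prop) (by fun_prop)
    (fun a ha ↦ ?_) a
  exact hdense (fun b ↦ L.weierstrassSigma (a + b) * L.weierstrassSigma (a - b)) (fun b ↦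
    L.weierstrassSigma a ^ 2 * L.sigmaSqWeierstrassP b -
      L.weierstrassSigma b ^ 2 * L.sigmaSqWeierstrassP a) (by fun_prop) (by fun_prop)
    (fun b hb ↦ L.weierstrassSigma_add_mul_sub_of_notMem ha hb) b

/-- The addition formula `σ(a + b) σ(a - b) = σ(a)² σ(b)² (℘(b) - ℘(a))`. -/
lemma weierstrassP_sub_mul_weierstrassSigma_sq {a b : ℂ} (ha : a ∉ L.lattice)
    (hb : b ∉ L.lattice) :
    (L.weierstrassP b - L.weierstrassP a) * (L.weierstrassSigma a ^ 2 * L.weierstrassSigma b ^ 2) =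
      L.weierstrassSigma (a + b) * L.weierstrassSigma (a - b) := by
  rw [weierstrassSigma_add_mul_sub, L.sigmaSqWeierstrassP_eq ha, L.sigmaSqWeierstrassP_eq hb]
  ring

/-! ### The three-term identity and the Baker–Akhiezer relations. -/

/-- Weierstrass's three-term identity for the sigma function. -/
lemma weierstrassSigma_three_term (a b c d : ℂ) :
    L.weierstrassSigma (a + b) * L.weierstrassSigma (a - b) *
        (L.weierstrassSigma (c + d) * L.weierstrassSigma (c - d)) +
      L.weierstrassSigma (b + c) * L.weierstrassSigma (b - c) *
        (L.weierstrassSigma (a + d) * L.weierstrassSigma (a - d)) +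
      L.weierstrassSigma (c + a) * L.weierstrassSigma (c - a) *
        (L.weierstrassSigma (b + d) * L.weierstrassSigma (b - d)) = 0 := by
  -- Each product becomes a 2×2 minor of the rows `σ²` and `σ'² - σ σ''`; the claim is the Plücker
  -- relation.
  simp only [weierstrassSigma_add_mul_sub]
  ring

/-- This is (ii) with denominators and exponentials removed. The half-sums are chosen so that `c + d
= x`, `c - d = y`, `a - b = u - v` and `a + b = u + v - (x + y)` in the three-term identity. -/
lemma weierstrassSigma_sub_mul_sub (x y u v : ℂ) :
    L.weierstrassSigma (u - v) * L.weierstrassSigma (u + v - (x + y)) *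
        (L.weierstrassSigma x * L.weierstrassSigma y) =
      L.weierstrassSigma (u - (x + y)) * L.weierstrassSigma u *
          (L.weierstrassSigma (v - x) * L.weierstrassSigma (v - y)) -
        L.weierstrassSigma (v - (x + y)) * L.weierstrassSigma v *
          (L.weierstrassSigma (u - x) * L.weierstrassSigma (u - y)) := by
  have h := L.weierstrassSigma_three_term (u - (x + y) / 2) (v - (x + y) / 2) ((x + y) / 2)
    ((x - y) / 2)
  have hneg := L.weierstrassSigma_neg (u - (x + y))
  ring_nf at h hneg ⊢
  rw [hneg] at h
  linear_combination h

lemma bakerAkhiezer_add {x α ν : ℂ} (hx : x ∉ L.lattice) (hα : α ∉ L.lattice)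
    (hν : ν ∉ L.lattice) (hνα : ν - α ∉ L.lattice) (hxα : x + α ∉ L.lattice) :
    L.bakerAkhiezer (x + α) ν =
      -Complex.exp
          ((L.weierstrassZeta (α - ν) + L.weierstrassZeta ν - L.weierstrassZeta α) * x) *
        L.bakerAkhiezer α ν *
        (L.bakerAkhiezer x (ν - α) / L.bakerAkhiezer (-x) α) := by
  rw [← L.weierstrassSigma_eq_zero_iff] at hx hα hν hνα hxα
  have hζ : L.weierstrassZeta (α - ν) = -L.weierstrassZeta (ν - α) := by
    rw [← weierstrassZeta_neg, neg_sub]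
  have hexp : Complex.exp (L.weierstrassZeta ν * (x + α)) *
      Complex.exp (L.weierstrassZeta α * -x) =
      Complex.exp ((L.weierstrassZeta (α - ν) + L.weierstrassZeta ν - L.weierstrassZeta α) * x) *
      Complex.exp (L.weierstrassZeta ν * α) * Complex.exp (L.weierstrassZeta (ν - α) * x) := by
    simp only [← Complex.exp_add, hζ]
    congr 1
    ring
  have h1 : α - -x = x + α := by ring
  have h2 : ν - α - x = ν - (x + α) := by ring
  simp only [bakerAkhiezer, weierstrassSigma_neg, h1, h2]
  have hne := Complex.exp_ne_zero (L.weierstrassZeta α * -x)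
  -- With the exponentials as opaque atoms, `hexp` is the only relation needed between them.
  generalize Complex.exp (L.weierstrassZeta α * -x) = E at *
  generalize Complex.exp (L.weierstrassZeta ν * (x + α)) = E₁ at *
  generalize Complex.exp ((L.weierstrassZeta (α - ν) + L.weierstrassZeta ν -
    L.weierstrassZeta α) * x) = E₂ at *
  generalize Complex.exp (L.weierstrassZeta ν * α) = E₃ at *
  generalize Complex.exp (L.weierstrassZeta (ν - α) * x) = E₄ at *
  field_simp
  linear_combination L.weierstrassSigma (ν - (x + α)) * hexp

lemma bakerAkhiezer_add_add {x y ν₁ ν₂ : ℂ} (hx : x ∉ L.lattice) (hy : y ∉ L.lattice)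
    (hxy : x + y ∉ L.lattice) (h₁ : ν₁ ∉ L.lattice) (h₂ : ν₂ ∉ L.lattice)
    (h₁₂ : ν₁ + ν₂ ∉ L.lattice) :
    (L.weierstrassP ν₂ - L.weierstrassP ν₁) *
        Complex.exp
          ((L.weierstrassZeta ν₁ + L.weierstrassZeta ν₂ - L.weierstrassZeta (ν₁ + ν₂)) *
            (x + y)) *
        L.bakerAkhiezer (x + y) (ν₁ + ν₂) =
      L.bakerAkhiezer (x + y) ν₁ * L.bakerAkhiezer x ν₂ * L.bakerAkhiezer y ν₂ -
        L.bakerAkhiezer (x + y) ν₂ * L.bakerAkhiezer x ν₁ * L.bakerAkhiezer y ν₁ := by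
  have hP := L.weierstrassP_sub_mul_weierstrassSigma_sq h₁ h₂
  have hσ := L.weierstrassSigma_sub_mul_sub x y ν₁ ν₂
  rw [← L.weierstrassSigma_eq_zero_iff] at hx hy hxy h₁ h₂ h₁₂
  -- Solving for `c` turns its poles into sigma denominators that cancel against those of `Φ`.
  rw [← eq_div_iff (by positivity)] at hP
  have hexp : Complex.exp
      ((L.weierstrassZeta ν₁ + L.weierstrassZeta ν₂ - L.weierstrassZeta (ν₁ + ν₂)) * (x + y)) =
      Complex.exp (L.weierstrassZeta ν₁ * x) * Complex.exp (L.weierstrassZeta ν₁ * y) *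
        (Complex.exp (L.weierstrassZeta ν₂ * x) * Complex.exp (L.weierstrassZeta ν₂ * y)) /
        Complex.exp (L.weierstrassZeta (ν₁ + ν₂) * (x + y)) := by
    simp only [← Complex.exp_add, ← Complex.exp_sub]
    congr 1
    ring
  have hne := Complex.exp_ne_zero (L.weierstrassZeta (ν₁ + ν₂) * (x + y))
  simp only [bakerAkhiezer, hP, hexp, mul_add (L.weierstrassZeta ν₁),
    mul_add (L.weierstrassZeta ν₂), Complex.exp_add]
  generalize Complex.exp (L.weierstrassZeta (ν₁ + ν₂) * (x + y)) = E at *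
  field_simp
  linear_combination hσ

end PeriodPair

theorem lemma6 (L : PeriodPair) :
    (∀ x α ν : ℂ, x ∉ L.lattice → α ∉ L.lattice → ν ∉ L.lattice →
      ν - α ∉ L.lattice → x + α ∉ L.lattice →
      L.bakerAkhiezer (x + α) ν =
        -Complex.exp
            ((L.weierstrassZeta (α - ν) + L.weierstrassZeta ν - L.weierstrassZeta α) * x) *
          L.bakerAkhiezer α ν *
          (L.bakerAkhiezer x (ν - α) / L.bakerAkhiezer (-x) α)) ∧
    (∀ x y ν₁ ν₂ : ℂ, x ∉ L.lattice → y ∉ L.lattice → x + y ∉ L.lattice →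
      ν₁ ∉ L.lattice → ν₂ ∉ L.lattice → ν₁ + ν₂ ∉ L.lattice →
      (L.weierstrassP ν₂ - L.weierstrassP ν₁) *
          Complex.exp
            ((L.weierstrassZeta ν₁ + L.weierstrassZeta ν₂ - L.weierstrassZeta (ν₁ + ν₂)) *
              (x + y)) *
          L.bakerAkhiezer (x + y) (ν₁ + ν₂) =
        L.bakerAkhiezer (x + y) ν₁ * L.bakerAkhiezer x ν₂ * L.bakerAkhiezer y ν₂ -
          L.bakerAkhiezer (x + y) ν₂ * L.bakerAkhiezer x ν₁ * L.bakerAkhiezer y ν₁) := by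
  exact ⟨fun _ _ _ ↦ L.bakerAkhiezer_add, fun _ _ _ _ ↦ L.bakerAkhiezer_add_add⟩
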